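/- Let $n\ge 1$ and $k>3$ be integers, and let $x_1,\dots,x_n$ be the coordinates on $\mathbb{C}^n$. Consider the following polynomials in $x_1,\dots,x_n$: - all $\binom{n+k-3}{n}$ monomials of degree at most $k-3$; - all $\binom{n+k-3}{n-1}-n$ monomials of degree $k-2$ that are not pure powers (that is, not equal to $x_i^{k-2}$ for any $i$); - the $n-1$ binomials $x_{i+1}^{k-1}-x_i^{k-2}$ for $i=1,\dots,n-1$; - the two powers $x_1^{k-1}$ and $x_n^{k-2}$. There are $\binom{n+k-2}{k-2}+1$ of them in total, and the map $$\mathbb{C}^n\longrightarrow\mathbb{C}^{\binom{n+k-2}{k-2}+1}$$ having these polynomials as its coordinates (listed in any order) is $k$-regular: the images of any $k$ distinct points of $\mathbb{C}^n$ are linearly independent over $\mathbb{C}$. -/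

import Mathlib

namespace KRegular

/-- A map `f : X → ℂ^N` is `k`-regular if the images of any `k` distinct points of `X` are
linearly independent. -/
def IsKRegular {X : Type*} {N : ℕ} (k : ℕ) (f : X → (Fin N → ℂ)) : Prop :=
  ∀ p : Fin k → X, Function.Injective p → LinearIndependent ℂ (fun i => f (p i))

/-- Exponents of the monomials in `x_1, …, x_n` of degree at most `k - 3`. -/
abbrev LowExponent (n k : ℕ) : Type :=
  {a : Fin n →₀ ℕ // a.degree ≤ k - 3}

/-- Exponents of the monomials in `x_1, …, x_n` of degree `k - 2` that are not pure powers. -/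
abbrev MixedExponent (n k : ℕ) : Type :=
  {a : Fin n →₀ ℕ // a.degree = k - 2 ∧ ∀ i : Fin n, a ≠ Finsupp.single i (k - 2)}

/-- The set of coordinates of the map: the monomials of degree at most `k - 3`, the mixed
monomials of degree `k - 2`, the `n - 1` binomials, and two further pure powers. -/
inductive Coord (n k : ℕ) : Type where
  | low (a : LowExponent n k) : Coord n k
  | mixed (a : MixedExponent n k) : Coord n k
  | binomial (i : Fin (n - 1)) : Coord n k
  | firstPower : Coord n k
  | lastPower : Coord n k

/-- The polynomial at each coordinate. The variables `x_1, …, x_n` are `X 0, …, X (n - 1)`, so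
`binomial i` is `x_{i+2}^{k-1} - x_{i+1}^{k-2}` for `i = 0, …, n - 2`, `firstPower` is
`x_1^{k-1}` and `lastPower` is `x_n^{k-2}`. -/
noncomputable def coordPoly (n k : ℕ) (hn : 1 ≤ n) : Coord n k → MvPolynomial (Fin n) ℂ
  | .low a => MvPolynomial.monomial a.1 1
  | .mixed a => MvPolynomial.monomial a.1 1
  | .binomial i =>
      MvPolynomial.X (⟨i.1 + 1, by omega⟩ : Fin n) ^ (k - 1)
        - MvPolynomial.X (⟨i.1, by omega⟩ : Fin n) ^ (k - 2)
  | .firstPower => MvPolynomial.X (⟨0, by omega⟩ : Fin n) ^ (k - 1)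
  | .lastPower => MvPolynomial.X (⟨n - 1, by omega⟩ : Fin n) ^ (k - 2)

/-- The polynomial map `ℂ^n → ℂ^N` whose `j`-th component is the polynomial at the coordinate
`e j`, for an enumeration `e` of the coordinates. -/
noncomputable def polyMap (n k : ℕ) (hn : 1 ≤ n) {N : ℕ} (e : Fin N ≃ Coord n k) :
    (Fin n → ℂ) → (Fin N → ℂ) :=
  fun x j => MvPolynomial.eval x (coordPoly n k hn (e j))

end KRegular

open MvPolynomial

namespace KRegular

/-! ### Counting the coordinates. -/

section Counting

/-! Put `k = d + 4` and restrict a linear relation among the images to its support `S`, so that all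
weights are nonzero. It kills every polynomial of degree at most `d + 1` and the mixed monomials of
degree `d + 2`. If it also kills `x_j^(d+2)`, then the weights multiplied by `x_j` again kill degree
`d + 1`. By `Annihilates.const_or_affine`, either `x_j` is constant on `S`, or `S` lies on a line
parametrized by `x_j`.

On such a line every `x_i^(d+2)` is killed, so a binomial (or `x_1^(d+3)`) gives the moment of `x_j`
of order `d + 3`. Then `d + 4` moments at no more than `d + 4` distinct values force the weights to
vanish. So `x_j` is constant, `x_j^(d+3)` is killed because the weights sum to zero, and the
binomial passes to `x_(j-1)^(d+2)`. Descending from `x_n`, all coordinates are constant; a single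
point cannot carry a relation. -/

lemma ncard_degree_eq (n m : ℕ) (hn : 1 ≤ n) :
    {a : Fin n →₀ ℕ | a.degree = m}.ncard = (n + m - 1).choose (n - 1) := by
  have h : Nat.card {P : Fin n →₀ ℕ // P.sum (fun _ => id) = m} = (n + m - 1).choose m := by
    rw [← Nat.card_congr (Sym.equivNatSum (Fin n) m), Nat.card_eq_fintype_card,
      Sym.card_sym_eq_choose, Fintype.card_fin]
  rw [← Nat.choose_symm_of_eq_add (show n + m - 1 = (n - 1) + m by omega)] at h
  exact h

lemma ncard_degree_le (n m : ℕ) (hn : 1 ≤ n) :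
    {a : Fin n →₀ ℕ | a.degree ≤ m}.ncard = (n + m).choose n := by
  induction m with
  | zero =>
    have h := ncard_degree_eq n 0 hn
    simpa using h
  | succ m ih =>
    have h : {a : Fin n →₀ ℕ | a.degree ≤ m + 1} =
        {a : Fin n →₀ ℕ | a.degree ≤ m} ∪ {a : Fin n →₀ ℕ | a.degree = m + 1} := by
      ext a
      simp only [Set.mem_ofPred_eq, Set.mem_union]
      omega
    rw [h, Set.ncard_union_eq _ (Finsupp.finite_of_degree_le m) (Finsupp.finite_of_degree_eq _),
      ih, ncard_degree_eq n (m + 1) hn]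
    · obtain ⟨n, rfl⟩ := Nat.exists_eq_add_of_le' hn
      rw [show n + 1 + (m + 1) = (n + 1 + m) + 1 by omega, Nat.choose_succ_succ]
      simp [add_comm]
    · rw [Set.disjoint_left]
      intro a ha hb
      simp only [Set.mem_ofPred_eq] at ha hb
      omega

lemma natCard_lowExponent (n k : ℕ) (hn : 1 ≤ n) (hk : 3 < k) :
    Nat.card (LowExponent n k) = (n + k - 3).choose n := by
  rw [show n + k - 3 = n + (k - 3) by omega, ← ncard_degree_le n (k - 3) hn]
  rfl

instance finite_lowExponent (n k : ℕ) : Finite (LowExponent n k) :=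
  (Finsupp.finite_of_degree_le (σ := Fin n) (k - 3)).to_subtype

instance finite_mixedExponent (n k : ℕ) : Finite (MixedExponent n k) :=
  ((Finsupp.finite_of_degree_eq (σ := Fin n) (k - 2)).subset fun _ h => h.1).to_subtype

lemma natCard_mixedExponent (n k : ℕ) (hn : 1 ≤ n) (hk : 3 < k) :
    Nat.card (MixedExponent n k) + n = (n + k - 3).choose (n - 1) := by
  have hinj : Function.Injective fun i : Fin n => Finsupp.single i (k - 2) :=
    Finsupp.single_left_injective (by omega)
  have h : {a : Fin n →₀ ℕ | a.degree = k - 2} =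
      {a : Fin n →₀ ℕ | a.degree = k - 2 ∧ ∀ i : Fin n, a ≠ Finsupp.single i (k - 2)} ∪
        Set.range fun i : Fin n => Finsupp.single i (k - 2) := by
    ext a
    simp only [Set.mem_ofPred_eq, Set.mem_union, Set.mem_range]
    constructor
    · intro ha
      by_cases hs : ∃ i, Finsupp.single i (k - 2) = a
      · exact Or.inr hs
      · exact Or.inl ⟨ha, fun i hi => hs ⟨i, hi.symm⟩⟩
    · rintro (ha | ⟨i, rfl⟩)
      · exact ha.1
      · exact Finsupp.degree_single _ _
  have hcard := ncard_degree_eq n (k - 2) hn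
  rw [h, Set.ncard_union_eq _ 
      ((Finsupp.finite_of_degree_eq (k - 2)).subset fun _ ha => ha.1) (Set.finite_range _),
    Set.ncard_range_of_injective hinj, Nat.card_fin] at hcard
  · rw [show n + k - 3 = n + (k - 2) - 1 by omega, ← hcard]
    rfl
  · rw [Set.disjoint_left]
    rintro a ha ⟨i, rfl⟩
    exact ha.2 i rfl

/-- The coordinates as an iterated disjoint sum. -/
def coordEquiv (n k : ℕ) :
    Coord n k ≃ (LowExponent n k ⊕ MixedExponent n k) ⊕ (Fin (n - 1) ⊕ Bool) where
  toFun
    | .low a => .inl (.inl a)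
    | .mixed a => .inl (.inr a)
    | .binomial i => .inr (.inl i)
    | .firstPower => .inr (.inr false)
    | .lastPower => .inr (.inr true)
  invFun
    | .inl (.inl a) => .low a
    | .inl (.inr a) => .mixed a
    | .inr (.inl i) => .binomial i
    | .inr (.inr false) => .firstPower
    | .inr (.inr true) => .lastPower
  left_inv q := by cases q <;> rfl
  right_inv q := by rcases q with (a | a) | (i | (_ | _)) <;> rfl

/-- The `n` excluded pure powers are traded for `n + 1` other coordinates, hence the `+ 1` over
Pascal's count. -/
lemma natCard_coord (n k : ℕ) (hn : 1 ≤ n) (hk : 3 < k) :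
    Nat.card (Coord n k) = (n + k - 2).choose (k - 2) + 1 := by
  rw [Nat.card_congr (coordEquiv n k), Nat.card_sum, Nat.card_sum, Nat.card_sum, Nat.card_fin,
    Nat.card_eq_fintype_card (α := Bool), Fintype.card_bool, natCard_lowExponent n k hn hk,
    Nat.choose_symm_of_eq_add (show n + k - 2 = (k - 2) + n by omega)]
  have hm := natCard_mixedExponent n k hn hk
  have hp : (n + k - 2).choose n = (n + k - 3).choose (n - 1) + (n + k - 3).choose n := by
    obtain ⟨n, rfl⟩ := Nat.exists_eq_add_of_le' hn
    rw [show n + 1 + k - 2 = (n + 1 + k - 3) + 1 by omega, Nat.choose_succ_succ]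
    rfl
  omega

end Counting

/-! ### Relations among point evaluations. -/

section Annihilation

variable {n : ℕ}

/-- The functional `f ↦ ∑ x ∈ S, c x * f x` vanishes on all polynomials of degree at most `d`. -/
def Annihilates (c : (Fin n → ℂ) → ℂ) (S : Finset (Fin n → ℂ)) (d : ℕ) : Prop :=
  ∀ f : MvPolynomial (Fin n) ℂ, f.totalDegree ≤ d → ∑ x ∈ S, c x * eval x f = 0

lemma annihilates_of_monomial {c : (Fin n → ℂ) → ℂ} {S : Finset (Fin n → ℂ)} {d : ℕ}
    (h : ∀ a : Fin n →₀ ℕ, a.degree ≤ d → ∑ x ∈ S, c x * eval x (monomial a (1 : ℂ)) = 0) :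
    Annihilates c S d := by
  intro f hf
  have hx : ∀ x, eval x f = ∑ a ∈ f.support, coeff a f * eval x (monomial a (1 : ℂ)) := by
    intro x
    rw [eval_eq]
    simp [eval_monomial, Finsupp.prod]
  simp_rw [hx, Finset.mul_sum]
  rw [Finset.sum_comm]
  refine Finset.sum_eq_zero fun a ha => ?_
  have hdeg : a.degree ≤ d := (le_totalDegree ha).trans hf
  rw [← mul_zero (coeff a f), ← h a hdeg, Finset.mul_sum]
  exact Finset.sum_congr rfl fun x _ => by ring

lemma Annihilates.mul {c : (Fin n → ℂ) → ℂ} {S : Finset (Fin n → ℂ)} {d e : ℕ}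
    (h : Annihilates c S (d + e)) {g : MvPolynomial (Fin n) ℂ} (hg : g.totalDegree ≤ e) :
    Annihilates (fun x => c x * eval x g) S d := by
  intro f hf
  rw [← h (f * g) ((totalDegree_mul f g).trans (add_le_add hf hg))]
  exact Finset.sum_congr rfl fun x _ => by rw [map_mul]; ring

lemma Annihilates.subset {c : (Fin n → ℂ) → ℂ} {S T : Finset (Fin n → ℂ)} {d : ℕ}
    (h : Annihilates c S d) (hT : T ⊆ S) (hc : ∀ x ∈ S, x ∉ T → c x = 0) :
    Annihilates c T d := by
  intro f hf
  rw [← h f hf]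
  exact Finset.sum_subset hT fun x hx hxT => by rw [hc x hx hxT, zero_mul]

/-- One affine-linear factor per point of `S`. -/
lemma exists_separating_polynomial (S : Finset (Fin n → ℂ)) (p : Fin n → ℂ) (hp : p ∉ S) :
    ∃ f : MvPolynomial (Fin n) ℂ, f.totalDegree ≤ S.card ∧ eval p f ≠ 0 ∧
      ∀ x ∈ S, eval x f = 0 := by
  have hne : ∀ x : Fin n → ℂ, ∃ f : MvPolynomial (Fin n) ℂ,
      x ≠ p → f.totalDegree ≤ 1 ∧ eval p f ≠ 0 ∧ eval x f = 0 := by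
    intro x
    by_cases hx : x = p
    · exact ⟨0, fun h => (h hx).elim⟩
    · obtain ⟨i, hi⟩ := Function.ne_iff.mp hx
      refine ⟨X i - C (x i), fun _ => ⟨?_, ?_, ?_⟩⟩
      · exact (totalDegree_sub_C_le _ _).trans (totalDegree_X i).le
      · simpa [sub_eq_zero] using Ne.symm hi
      · simp
  choose f hf using hne
  have hxp : ∀ x ∈ S, x ≠ p := fun x hx h => hp (h ▸ hx)
  refine ⟨∏ x ∈ S, f x, ?_, ?_, ?_⟩
  · refine (totalDegree_finsetProd _ _).trans ?_
    simpa using Finset.sum_le_card_nsmul S _ 1 fun x hx => (hf x (hxp x hx)).1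
  · rw [map_prod, Finset.prod_ne_zero_iff]
    exact fun x hx => (hf x (hxp x hx)).2.1
  · intro x hx
    rw [map_prod]
    exact Finset.prod_eq_zero hx (hf x (hxp x hx)).2.2

lemma Annihilates.eq_zero {c : (Fin n → ℂ) → ℂ} {S : Finset (Fin n → ℂ)} {d : ℕ}
    (h : Annihilates c S d) (hS : S.card ≤ d + 1) : ∀ p ∈ S, c p = 0 := by
  intro p hp
  obtain ⟨f, hdeg, hfp, hf⟩ := exists_separating_polynomial (S.erase p) p (by simp)
  have hcard := Finset.card_erase_of_mem hp
  have hsum := h f (by omega)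
  rw [Finset.sum_eq_single_of_mem p hp fun x hx hxp => by
    rw [hf x (Finset.mem_erase.mpr ⟨hxp, hx⟩), mul_zero]] at hsum
  exact (mul_eq_zero.mp hsum).resolve_right hfp

/-- A nowhere vanishing relation in degree `d` between at most `d + 2` points forces the points to
be collinear. -/
lemma Annihilates.collinear {c : (Fin n → ℂ) → ℂ} {S : Finset (Fin n → ℂ)} {d : ℕ}
    (h : Annihilates c S (d + 1)) (hS : S.card ≤ d + 3) (hc : ∀ x ∈ S, c x ≠ 0)
    {p q r : Fin n → ℂ} (hp : p ∈ S) (hq : q ∈ S) (hr : r ∈ S) (hpq : p ≠ q) (a b : Fin n) :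
    (r a - p a) * (q b - p b) = (r b - p b) * (q a - p a) := by
  by_contra hne
  -- An affine form vanishing at `p` and `q` but not at `r`: absorbing it into the weights costs one
  -- degree and removes two points.
  set g : MvPolynomial (Fin n) ℂ :=
    (X a - C (p a)) * C (q b - p b) - (X b - C (p b)) * C (q a - p a) with hgdef
  have hlin : ∀ (i : Fin n) (s t : ℂ),
      ((X i - C s) * C t : MvPolynomial (Fin n) ℂ).totalDegree ≤ 1 := by
    intro i s t
    refine (totalDegree_mul _ _).trans ?_
    rw [totalDegree_C, add_zero]
    exact (totalDegree_sub_C_le _ _).trans (totalDegree_X i).le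
  have hg : g.totalDegree ≤ 1 := (totalDegree_sub _ _).trans (max_le (hlin _ _ _) (hlin _ _ _))
  have heval : ∀ x, eval x g = (x a - p a) * (q b - p b) - (x b - p b) * (q a - p a) := by
    intro x
    simp [hgdef]
  have hgr : eval r g ≠ 0 := by
    rw [heval]
    exact sub_ne_zero.mpr hne
  have hgp : eval p g = 0 := by rw [heval]; ring
  have hgq : eval q g = 0 := by rw [heval]; ring
  have hT : Annihilates (fun x => c x * eval x g) ((S.erase p).erase q) d := by
    refine (h.mul hg).subset ((Finset.erase_subset _ _).trans (Finset.erase_subset _ _)) ?_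
    intro x hx hxT
    simp only [Finset.mem_erase, not_and] at hxT
    by_cases hxq : x = q
    · rw [hxq, hgq, mul_zero]
    · by_cases hxp : x = p
      · rw [hxp, hgp, mul_zero]
      · exact absurd hx (hxT hxq hxp)
  have hcard : ((S.erase p).erase q).card ≤ d + 1 := by
    rw [Finset.card_erase_of_mem (Finset.mem_erase.mpr ⟨hpq.symm, hq⟩),
      Finset.card_erase_of_mem hp]
    omega
  have hrT : r ∈ (S.erase p).erase q := by
    refine Finset.mem_erase.mpr ⟨?_, Finset.mem_erase.mpr ⟨?_, hr⟩⟩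
    · rintro rfl
      exact hgr hgq
    · rintro rfl
      exact hgr hgp
  exact mul_ne_zero (hc r hr) hgr (hT.eq_zero hcard r hrT)

/-- If in addition the relation holds for the products of `X j` with polynomials of degree
`d + 1`, then either the `j`-th coordinate is constant, or there are exactly `d + 4` points and
their `j`-th coordinates are distinct and determine the other coordinates affinely. -/
lemma Annihilates.const_or_affine {c : (Fin n → ℂ) → ℂ} {S : Finset (Fin n → ℂ)} {d : ℕ}
    (h : Annihilates c S (d + 1)) (hS : S.card ≤ d + 4) (hc : ∀ x ∈ S, c x ≠ 0) {j : Fin n}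
    (hj : Annihilates (fun x => c x * x j) S (d + 1)) :
    (∀ x ∈ S, ∀ y ∈ S, x j = y j) ∨
      (Set.InjOn (fun x : Fin n → ℂ => x j) S ∧
        ∀ i, ∃ s t : ℂ, ∀ x ∈ S, x i = s + t * x j) := by
  by_cases hconst : ∀ x ∈ S, ∀ y ∈ S, x j = y j
  · exact Or.inl hconst
  right
  have hshift : ∀ p : Fin n → ℂ, Annihilates (fun x => c x * (x j - p j)) S (d + 1) := by
    intro p f hf
    have h1 := hj f hf
    have h2 := h f hf
    calc ∑ x ∈ S, c x * (x j - p j) * eval x f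
        = ∑ x ∈ S, (c x * x j * eval x f - p j * (c x * eval x f)) :=
          Finset.sum_congr rfl fun x _ => by ring
      _ = 0 := by rw [Finset.sum_sub_distrib, ← Finset.mul_sum, h1, h2]; simp
  -- The factor `x j - p j` discards the points sharing the `j`-th coordinate of `p`, without
  -- lowering the degree.
  have hrest : ∀ p : Fin n → ℂ,
      Annihilates (fun x => c x * (x j - p j)) (S.filter fun x => x j ≠ p j) (d + 1) := by
    intro p
    refine (hshift p).subset (Finset.filter_subset _ _) fun x hx hxT => ?_
    have : x j = p j := by
      by_contra hne
      exact hxT (Finset.mem_filter.mpr ⟨hx, hne⟩)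
    simp [this]
  have hcoef : ∀ p : Fin n → ℂ, ∀ x ∈ S.filter fun x => x j ≠ p j, c x * (x j - p j) ≠ 0 := by
    intro p x hx
    rw [Finset.mem_filter] at hx
    exact mul_ne_zero (hc x hx.1) (sub_ne_zero.mpr hx.2)
  have hne : ∀ p ∈ S, ∃ q ∈ S, q j ≠ p j := by
    intro p hp
    by_contra! hall
    exact hconst fun x hx y hy => (hall x hx).trans (hall y hy).symm
  have hlarge : ∀ p ∈ S, d + 3 ≤ (S.filter fun x => x j ≠ p j).card := by
    intro p hp
    by_contra! hlt
    obtain ⟨q, hq, hqp⟩ := hne p hp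
    have hqT : q ∈ S.filter fun x => x j ≠ p j := Finset.mem_filter.mpr ⟨hq, hqp⟩
    exact hcoef p q hqT ((hrest p).eq_zero (by omega) q hqT)
  have hsub : ∀ p ∈ S, (S.filter fun x => x j ≠ p j) ⊆ S.erase p := by
    intro p _ x hx
    rw [Finset.mem_filter] at hx
    exact Finset.mem_erase.mpr ⟨fun hxp => hx.2 (by rw [hxp]), hx.1⟩
  have hSne : S.Nonempty := by
    rw [Finset.nonempty_iff_ne_empty]
    rintro rfl
    exact hconst (by simp)
  have heq : ∀ p ∈ S, (S.filter fun x => x j ≠ p j) = S.erase p := by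
    intro p hp
    refine Finset.eq_of_subset_of_card_le (hsub p hp) ?_
    rw [Finset.card_erase_of_mem hp]
    have := hlarge p hp
    omega
  have hinj : Set.InjOn (fun x : Fin n → ℂ => x j) S := by
    intro x hx y hy hxy
    by_contra hxyne
    have hmem : x ∈ S.erase y := Finset.mem_erase.mpr ⟨hxyne, hx⟩
    rw [← heq y hy, Finset.mem_filter] at hmem
    exact hmem.2 hxy
  have hcol : ∀ p ∈ S, ∀ q ∈ S, ∀ r ∈ S, p ≠ q → ∀ a b : Fin n,
      (r a - p a) * (q b - p b) = (r b - p b) * (q a - p a) := by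
    intro p hp q hq r hr hpq a b
    -- `S` has at least `d + 4 ≥ 4` points; discarding `o` leaves the `d + 3` that
    -- `Annihilates.collinear` allows.
    obtain ⟨o, ho, hopqr⟩ : ∃ o ∈ S, o ∉ ({p, q, r} : Finset (Fin n → ℂ)) := by
      apply Finset.exists_mem_notMem_of_card_lt_card
      have h3 : ({p, q, r} : Finset (Fin n → ℂ)).card ≤ 3 := Finset.card_le_three
      have h4 := (hlarge p hp).trans (Finset.card_le_card (hsub p hp))
      rw [Finset.card_erase_of_mem hp] at h4
      omega
    simp only [Finset.mem_insert, Finset.mem_singleton, not_or] at hopqr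
    have hmem : ∀ x ∈ S, o ≠ x → x ∈ S.filter fun x => x j ≠ o j := by
      intro x hx hox
      rw [heq o ho]
      exact Finset.mem_erase.mpr ⟨Ne.symm hox, hx⟩
    refine (hrest o).collinear ?_ (hcoef o) (hmem p hp hopqr.1) (hmem q hq hopqr.2.1)
      (hmem r hr hopqr.2.2) hpq a b
    rw [heq o ho, Finset.card_erase_of_mem ho]
    omega
  refine ⟨hinj, fun i => ?_⟩
  obtain ⟨p, hp⟩ := hSne
  obtain ⟨q, hq, hqp⟩ := hne p hp
  have hd : q j - p j ≠ 0 := sub_ne_zero.mpr hqp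
  refine ⟨p i - p j * ((q i - p i) / (q j - p j)), (q i - p i) / (q j - p j), fun x hx => ?_⟩
  have := hcol p hp q hq x hx (fun h => hqp (by rw [h])) i j
  field_simp
  linear_combination this

lemma sum_mul_eval_eq_zero_of_pow {ι : Type*} {S : Finset ι} {c t : ι → ℂ} {m : ℕ}
    (h : ∀ r ≤ m, ∑ x ∈ S, c x * t x ^ r = 0) {f : Polynomial ℂ} (hf : f.natDegree ≤ m) :
    ∑ x ∈ S, c x * f.eval (t x) = 0 := by
  simp_rw [Polynomial.eval_eq_sum_range, Finset.mul_sum]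
  rw [Finset.sum_comm]
  refine Finset.sum_eq_zero fun r hr => ?_
  rw [Finset.mem_range] at hr
  rw [← mul_zero (f.coeff r), ← h r (by omega), Finset.mul_sum]
  exact Finset.sum_congr rfl fun x _ => by ring

/-- Nonsingularity of the Vandermonde system, by testing against the product of the `X - t y` over
the other points. -/
lemma eq_zero_of_sum_mul_pow {ι : Type*} {S : Finset ι} {c t : ι → ℂ} {m : ℕ}
    (h : ∀ r ≤ m, ∑ x ∈ S, c x * t x ^ r = 0) (ht : Set.InjOn t S) (hS : S.card ≤ m + 1) :
    ∀ x ∈ S, c x = 0 := by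
  classical
  intro x hx
  have hcard := Finset.card_erase_of_mem hx
  have hsum := sum_mul_eval_eq_zero_of_pow h
    (f := ∏ y ∈ S.erase x, (Polynomial.X - Polynomial.C (t y))) (by
      rw [Polynomial.natDegree_finsetProd_X_sub_C_eq_card]
      omega)
  rw [Finset.sum_eq_single_of_mem x hx] at hsum
  · refine (mul_eq_zero.mp hsum).resolve_right ?_
    refine Polynomial.eval_prod (S.erase x) _ (t x) ▸ Finset.prod_ne_zero_iff.mpr ?_
    intro y hy
    rw [Finset.mem_erase] at hy
    simp only [Polynomial.eval_sub, Polynomial.eval_X, Polynomial.eval_C]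
    exact sub_ne_zero.mpr fun hxy => hy.1 (ht hy.2 hx hxy.symm)
  · intro y hy hyx
    rw [Polynomial.eval_prod, Finset.prod_eq_zero (Finset.mem_erase.mpr ⟨hyx, hy⟩), mul_zero]
    simp

/-- A nowhere vanishing relation between at most `d + 4` points that holds for all the
coordinate polynomials has empty support. -/
lemma eq_empty_of_relation (hn : 1 ≤ n) {d : ℕ} {c : (Fin n → ℂ) → ℂ} {S : Finset (Fin n → ℂ)}
    (hS : S.card ≤ d + 4) (hc : ∀ x ∈ S, c x ≠ 0)
    (hrel : ∀ q : Coord n (d + 4), ∑ x ∈ S, c x * eval x (coordPoly n (d + 4) hn q) = 0) :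
    S = ∅ := by
  have hlow : Annihilates c S (d + 1) :=
    annihilates_of_monomial fun a ha => hrel (.low ⟨a, ha⟩)
  have hbin : ∀ i (hi : i + 1 < n),
      ∑ x ∈ S, c x * x ⟨i + 1, hi⟩ ^ (d + 3) = ∑ x ∈ S, c x * x ⟨i, by omega⟩ ^ (d + 2) := by
    intro i hi
    have := hrel (.binomial ⟨i, by omega⟩)
    simp only [coordPoly, map_sub, map_pow, eval_X, mul_sub, Finset.sum_sub_distrib] at this
    exact sub_eq_zero.mp this
  have hfirst : ∑ x ∈ S, c x * x ⟨0, by omega⟩ ^ (d + 3) = 0 := by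
    have := hrel .firstPower
    simp only [coordPoly, map_pow, eval_X] at this
    exact this
  have hlast : ∑ x ∈ S, c x * x ⟨n - 1, by omega⟩ ^ (d + 2) = 0 := by
    have := hrel .lastPower
    simp only [coordPoly, map_pow, eval_X] at this
    exact this
  have hone : ∑ x ∈ S, c x = 0 := by
    simpa using hlow 1 (by simp)
  have hpow : ∀ (j : Fin n), ∀ r ≤ d + 1, ∑ x ∈ S, c x * x j ^ r = 0 := by
    intro j r hr
    simpa using hlow (X j ^ r) (by rwa [totalDegree_X_pow])
  have hstep : ∀ j : Fin n, ∑ x ∈ S, c x * x j ^ (d + 2) = 0 → ∀ x ∈ S, ∀ y ∈ S, x j = y j := by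
    intro j hj
    have hmul : Annihilates (fun x => c x * x j) S (d + 1) := by
      refine annihilates_of_monomial fun a ha => ?_
      have hshift : ∑ x ∈ S, c x * x j * eval x (monomial a (1 : ℂ)) =
          ∑ x ∈ S, c x * eval x (monomial (a + Finsupp.single j 1) (1 : ℂ)) := by
        refine Finset.sum_congr rfl fun x _ => ?_
        rw [monomial_add_single, map_mul, map_pow, eval_X]
        ring
      rw [hshift]
      have hdeg : (a + Finsupp.single j 1).degree = a.degree + 1 := by
        rw [map_add, Finsupp.degree_single]
      rcases Nat.lt_or_ge a.degree (d + 1) with hlt | hge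
      · exact hrel (.low ⟨_, by rw [hdeg]; omega⟩)
      -- The only pure power of this degree divisible by `X j` is that of `X j` itself, which `hj`
      -- covers.
      · by_cases hs : ∃ i, a + Finsupp.single j 1 = Finsupp.single i (d + 2)
        · obtain ⟨i, hi⟩ := hs
          have hij : i = j := by
            by_contra hne
            have := DFunLike.congr_fun hi j
            simp [hne] at this
          rw [hi, hij, ← hj]
          simp only [← X_pow_eq_monomial, map_pow, eval_X]
        · push Not at hs
          exact hrel (.mixed ⟨_, by rw [hdeg]; omega, hs⟩)
    rcases hlow.const_or_affine hS hc hmul with hconst | ⟨hinj, haff⟩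
    · exact hconst
    have hpow2 : ∀ r ≤ d + 2, ∑ x ∈ S, c x * x j ^ r = 0 := by
      intro r hr
      rcases Nat.lt_or_ge r (d + 2) with hlt | hge
      · exact hpow j r (by omega)
      · rwa [show r = d + 2 by omega]
    have hall : ∀ i : Fin n, ∑ x ∈ S, c x * x i ^ (d + 2) = 0 := by
      intro i
      obtain ⟨s, t, hst⟩ := haff i
      have := sum_mul_eval_eq_zero_of_pow hpow2
        (f := (Polynomial.C t * Polynomial.X + Polynomial.C s) ^ (d + 2)) (by
          refine Polynomial.natDegree_pow_le.trans ?_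
          have : (Polynomial.C t * Polynomial.X + Polynomial.C s).natDegree ≤ 1 :=
            Polynomial.natDegree_linear_le
          nlinarith)
      rw [← this]
      refine Finset.sum_congr rfl fun x hx => ?_
      rw [hst x hx]
      simp [add_comm]
    have htop : ∑ x ∈ S, c x * x j ^ (d + 3) = 0 := by
      obtain ⟨j, hjn⟩ := j
      cases j with
      | zero => exact hfirst
      | succ i => rw [hbin i hjn, hall]
    have hzero := eq_zero_of_sum_mul_pow (m := d + 3) (fun r hr => by
      rcases Nat.lt_or_ge r (d + 3) with hlt | hge
      · exact hpow2 r (by omega)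
      · rwa [show r = d + 3 by omega]) hinj hS
    intro x hx
    exact absurd (hzero x hx) (hc x hx)
  -- Descent from the last variable, with `m` counting steps down.
  have hpowzero : ∀ m (hm : m < n), ∑ x ∈ S, c x * x ⟨n - 1 - m, by omega⟩ ^ (d + 2) = 0 := by
    intro m
    induction m with
    | zero => exact fun _ => hlast
    | succ m ih =>
      intro hm
      have hconst := hstep _ (ih (by omega))
      rw [← hbin (n - 1 - (m + 1)) (by omega)]
      have hidx : n - 1 - (m + 1) + 1 = n - 1 - m := by omega
      simp only [hidx]
      rcases S.eq_empty_or_nonempty with rfl | ⟨p, hp⟩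
      · simp
      rw [Finset.sum_congr rfl fun x hx => by rw [hconst x hx p hp], ← Finset.sum_mul, hone,
        zero_mul]
  have hconst : ∀ x ∈ S, ∀ y ∈ S, x = y := by
    intro x hx y hy
    funext j
    refine hstep j ?_ x hx y hy
    have := hpowzero (n - 1 - j) (by omega)
    have hidx : n - 1 - (n - 1 - (j : ℕ)) = j := by omega
    simpa only [hidx] using this
  by_contra hne
  obtain ⟨p, hp⟩ := Finset.nonempty_iff_ne_empty.mpr hne
  exact hc p hp (hlow.eq_zero ((Finset.card_le_one.mpr hconst).trans (by omega)) p hp)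

end Annihilation

/-! ### From relations to `k`-regularity. -/

lemma isKRegular_polyMap (n k : ℕ) (hn : 1 ≤ n) (hk : 3 < k) {N : ℕ} (e : Fin N ≃ Coord n k) :
    IsKRegular k (polyMap n k hn e) := by
  classical
  obtain ⟨d, rfl⟩ : ∃ d, k = d + 4 := ⟨k - 4, by omega⟩
  intro p hp
  rw [Fintype.linearIndependent_iff]
  intro g hg
  -- Coefficients become weights on points, extended by zero off the range of `p`.
  have hext : ∀ i, Function.extend p g 0 (p i) = g i := fun i => hp.extend_apply g 0 i
  have hempty := eq_empty_of_relation hn (c := Function.extend p g 0)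
    (d := d) (S := (Finset.univ.filter fun i => g i ≠ 0).image p)
    (by
      refine Finset.card_image_le.trans ((Finset.card_filter_le _ _).trans ?_)
      simp)
    (by
      intro x hx
      obtain ⟨i, hi, rfl⟩ := Finset.mem_image.mp hx
      rw [hext]
      exact (Finset.mem_filter.mp hi).2)
    (by
      intro q
      rw [Finset.sum_image hp.injOn]
      have hq := congrFun hg (e.symm q)
      simp only [Finset.sum_apply, Pi.smul_apply, smul_eq_mul, polyMap, Equiv.apply_symm_apply,
        Pi.zero_apply] at hq
      refine Eq.trans ?_ hq
      simp only [hext]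
      refine Finset.sum_subset (Finset.filter_subset _ _) fun i _ hi => ?_
      have : g i = 0 := by
        by_contra hne
        exact hi (Finset.mem_filter.mpr ⟨Finset.mem_univ i, hne⟩)
      rw [this, zero_mul])
  intro i
  simpa using Finset.filter_eq_empty_iff.mp (Finset.image_eq_empty.mp hempty) (Finset.mem_univ i)

end KRegular

theorem mainTheorem2 (n k : ℕ) (hn : 1 ≤ n) (hk : 3 < k) :
    Nat.card (KRegular.LowExponent n k) = (n + k - 3).choose n ∧
    Nat.card (KRegular.MixedExponent n k) + n = (n + k - 3).choose (n - 1) ∧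
    Nat.card (KRegular.Coord n k) = (n + k - 2).choose (k - 2) + 1 ∧
    ∀ e : Fin ((n + k - 2).choose (k - 2) + 1) ≃ KRegular.Coord n k,
      KRegular.IsKRegular k (KRegular.polyMap n k hn e) :=
  ⟨KRegular.natCard_lowExponent n k hn hk, KRegular.natCard_mixedExponent n k hn hk,
    KRegular.natCard_coord n k hn hk, fun e => KRegular.isKRegular_polyMap n k hn hk e⟩
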